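/- Let $A\in\mathbb R^{n\times n}$, $B_1\in\mathbb R^{n\times p_1}$, $B_2\in\mathbb R^{n\times p_2}$, $C_1\in\mathbb R^{q_1\times n}$, $C_2\in\mathbb R^{q_2\times n}$, $D_{12}\in\mathbb R^{q_1\times p_2}$, $D_{21}\in\mathbb R^{q_2\times p_1}$, where all eigenvalues of $A$ lie in the open unit disc and $D_{12}^TD_{12}$ and $D_{21}D_{21}^T$ are positive definite. Write $$\left[\begin{array}{c|c}A&B\\\hline C&D\end{array}\right](z)=C(zI-A)^{-1}B+D ,$$ and put $$P_{11}=\left[\begin{array}{c|c}A&B_1\\\hline C_1&0\end{array}\right],\quad P_{12}=\left[\begin{array}{c|c}A&B_2\\\hline C_1&D_{12}\end{array}\right],\quad P_{21}=\left[\begin{array}{c|c}A&B_1\\\hline C_2&D_{21}\end{array}\right].$$ Let $H_2$ (for each matrix size) be the Hilbert space of matrix functions $G(z)=\sum_{i\ge 0}z^{-i}G_i$, $|z|>1$, with complex matrix coefficients satisfying $\sum_i \mathrm{Tr}(G_iG_i^*)<\infty$, with inner product $\langle G,H\rangle=\sum_i\mathrm{Tr}(G_iH_i^*)$. Let $\mathbb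 P_{\mathcal M}$ denote the orthogonal projection onto a closed subspace $\mathcal M$. Suppose that the real symmetric matrices $X$ and $Y$ are stabilizing solutions of the Riccati equations $$X=C_1^TC_1+A^TXA-(A^TXB_2+C_1^TD_{12})\Omega^{-1}(B_2^TXA+D_{12}^TC_1),\qquad \Omega=D_{12}^TD_{12}+B_2^TXB_2,$$ $$Y=B_1B_1^T+AYA^T-(AYC_2^T+B_1D_{21}^T)\Psi^{-1}(C_2YA^T+D_{21}B_1^T),\qquad \Psi=D_{21}D_{21}^T+C_2YC_2^T,$$ that is, $\Omega$ and $\Psi$ are invertible and, with the gains $$K=-\Omega^{-1}(B_2^TXA+D_{12}^TC_1),\qquad L=-(AYC_2^T+B_1D_{21}^T)\Psi^{-1},$$ all eigenvalues of $A+B_2K$ and of $A+LC_2$ lie in the open unit disc. Define $$W_L=\left[\begin{array}{c|c}A+B_2K&B_2\\\hline K&I\end{array}\right]\Omega^{-1/2},\quad W_R=\Psi^{-1/2}\left[\begin{array}{c|c}A+LC_2&L\\\hline C_2&I\end{array}\right],\quad T=\Omega^{1/2}\left[\begin{array}{c|c}A&L\\\hline K&0\end{array}\right]\Psi^{1/2}.$$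 Then, for every $N\ge1$, $T\in H_2$, the function $P_{11}+P_{12}QP_{21}$ is in $H_2$ for every $p_2\times q_2$ matrix function $Q\in H_2$, and the problem $$\min_Q\ \|P_{11}+P_{12}QP_{21}\|_{H_2}\qquad\text{subject to } Q\in \tfrac{1}{z^{N+1}}H_2$$ has exactly one optimal solution, namely $$Q_N=-W_L\,\mathbb P_{\frac1{z^{N+1}}H_2}(T)\,W_R .$$ -/

import Mathlib

open scoped Matrix MatrixOrder ENNReal

noncomputable section

namespace ModelMatching

/-- The open exterior of the closed unit disc, on which transfer functions are evaluated. -/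
abbrev ExtDisc : Type := {z : ℂ // 1 < ‖z‖}

/-- A `p × q` matrix valued function of the variable `z`, `|z| > 1`. -/
abbrev TransferFun (p q : ℕ) : Type := ExtDisc → Matrix (Fin p) (Fin q) ℂ

/-- The Hilbert space `H₂` of `p × q` transfer matrices `G(z) = ∑ z⁻ⁱ Gᵢ` with
`∑ Tr (Gᵢ Gᵢ*) < ∞`: an element is the square summable sequence of its coefficients `Gᵢ`
(the matrix `Gᵢ` is stored as the Euclidean vector of its entries, so that its norm is the
Frobenius norm), with inner product `∑ Tr (Gᵢ Hᵢ*)` (linear in the factor that Mathlib puts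
second). The function `z ↦ G(z)` is `H2.eval G`. -/
abbrev H2 (p q : ℕ) : Type := lp (fun _ : ℕ => EuclideanSpace ℂ (Fin p × Fin q)) 2

/-- The coefficient matrix `Gᵢ` of `z⁻ⁱ`. -/
def H2.coeff {p q : ℕ} (G : H2 p q) (i : ℕ) : Matrix (Fin p) (Fin q) ℂ :=
  Matrix.of fun a b => G i (a, b)

/-- The function `G(z) = ∑ z⁻ⁱ Gᵢ` (the series converges absolutely for `|z| > 1`). -/
def H2.eval {p q : ℕ} (G : H2 p q) : TransferFun p q := fun z =>
  ∑' i : ℕ, ((z : ℂ)⁻¹) ^ i • H2.coeff G i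

/-- The function `F` belongs to `H₂`. -/
def IsH2 {p q : ℕ} (F : TransferFun p q) : Prop := ∃ G : H2 p q, H2.eval G = F

/-- The `H₂` norm of a function, with value `∞` if the function is not in `H₂`. -/
def h2Norm {p q : ℕ} (F : TransferFun p q) : ℝ≥0∞ :=
  ⨅ (G : H2 p q) (_ : H2.eval G = F), ‖G‖ₑ

/-- The subspace `z⁻ᵏ H₂` of `H₂`: the series `∑_{i ≥ k} z⁻ⁱ Gᵢ`. -/
def delayedH2 (p q k : ℕ) : Submodule ℂ (H2 p q) where
  carrier := {G | ∀ i < k, G i = 0}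
  add_mem' := by
    intro G H hG hH i hi
    simp [hG i hi, hH i hi]
  zero_mem' := by
    intro i _
    simp
  smul_mem' := by
    intro c G hG i hi
    simp [hG i hi]

theorem isClosed_delayedH2 (p q k : ℕ) : IsClosed (delayedH2 p q k : Set (H2 p q)) := by
  have h : (delayedH2 p q k : Set (H2 p q)) = ⋂ i, ⋂ (_ : i < k), {G : H2 p q | G i = 0} := by
    ext G
    simp only [Set.mem_iInter, Set.mem_ofPred_eq]
    rfl
  rw [h]
  refine isClosed_iInter fun i => isClosed_iInter fun _ => ?_
  have hc : Continuous fun G : H2 p q => G i := by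
    refine (LipschitzWith.of_dist_le_mul (K := 1) fun G H => ?_).continuous
    rw [dist_eq_norm, dist_eq_norm]
    simpa using lp.norm_apply_le_norm two_ne_zero (G - H) i
  exact isClosed_eq hc continuous_const

instance (p q k : ℕ) : CompleteSpace (delayedH2 p q k) :=
  (isClosed_delayedH2 p q k).completeSpace_coe

theorem H2.norm_sq {p q : ℕ} (G : H2 p q) :
    ‖G‖ ^ 2 = ∑' i, ((H2.coeff G i * (H2.coeff G i)ᴴ).trace).re := by
  have h := lp.norm_rpow_eq_tsum (p := 2) (by norm_num) G
  have e : ∀ i, ‖G i‖ ^ 2 = ((H2.coeff G i * (H2.coeff G i)ᴴ).trace).re := by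
    intro i
    rw [EuclideanSpace.norm_sq_eq, Fintype.sum_prod_type, Matrix.trace, Complex.re_sum]
    refine Finset.sum_congr rfl fun a _ => ?_
    rw [Matrix.diag_apply, Matrix.mul_apply, Complex.re_sum]
    refine Finset.sum_congr rfl fun b _ => ?_
    simp [H2.coeff, Complex.mul_conj, Complex.normSq_eq_norm_sq]
    norm_cast
  simp only [← e]
  simpa using h

theorem H2.summable_coeff {p q : ℕ} (G : H2 p q) {w : ℂ} (hw : ‖w‖ < 1) (a : Fin p) (b : Fin q) :
    Summable fun i : ℕ => w ^ i * H2.coeff G i a b := by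
  refine Summable.of_norm_bounded
    ((summable_geometric_of_lt_one (norm_nonneg _) hw).mul_right ‖G‖) fun i => ?_
  have h1 : ‖H2.coeff G i a b‖ ≤ ‖G‖ :=
    (PiLp.norm_apply_le (G i) (a, b)).trans (lp.norm_apply_le_norm two_ne_zero G i)
  rw [norm_mul, norm_pow]
  exact mul_le_mul_of_nonneg_left h1 (by positivity)

/-- The series that defines `G(z)` converges. -/
theorem H2.hasSum_eval {p q : ℕ} (G : H2 p q) (z : ExtDisc) :
    HasSum (fun i : ℕ => ((z : ℂ)⁻¹) ^ i • H2.coeff G i) (H2.eval G z) := by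
  have hz : ‖(z : ℂ)⁻¹‖ < 1 := by
    rw [norm_inv]
    exact inv_lt_one_of_one_lt₀ z.2
  exact Summable.hasSum (Pi.summable.2 fun a => Pi.summable.2 fun b => H2.summable_coeff G hz a b)

/-- An element of `H₂` is determined by its function. -/
theorem H2.eval_injective (p q : ℕ) :
    Function.Injective (H2.eval : H2 p q → TransferFun p q) := by
  intro G H h
  have key : ∀ (G : H2 p q) (a : Fin p) (b : Fin q),
      HasFPowerSeriesAt (fun w : ℂ => ∑' i : ℕ, w ^ i * H2.coeff G i a b)
        (FormalMultilinearSeries.ofScalars ℂ fun i => H2.coeff G i a b) 0 := by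
    intro G a b
    rw [hasFPowerSeriesAt_iff]
    filter_upwards [Metric.ball_mem_nhds (0 : ℂ) one_pos] with w hw
    simpa using (H2.summable_coeff G (by simpa using hw) a b).hasSum
  have ev : ∀ (G : H2 p q) (a : Fin p) (b : Fin q) (z : ExtDisc),
      H2.eval G z a b = ∑' i : ℕ, ((z : ℂ)⁻¹) ^ i * H2.coeff G i a b := fun G a b z =>
    (Pi.hasSum.1 (Pi.hasSum.1 (H2.hasSum_eval G z) a) b).tsum_eq.symm
  ext i ⟨a, b⟩
  have e1 := (AnalyticAt.frequently_eq_iff_eventually_eq (key G a b).analyticAt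
    (key H a b).analyticAt).1 <| Filter.Eventually.frequently <| by
      filter_upwards [self_mem_nhdsWithin,
        mem_nhdsWithin_of_mem_nhds (Metric.ball_mem_nhds (0 : ℂ) one_pos)] with w hw0 hw
      have hw1 : 1 < ‖w⁻¹‖ := by
        rw [norm_inv]
        exact (one_lt_inv₀ (norm_pos_iff.2 hw0)).2 (by simpa using hw)
      have := congrFun (congrFun (congrFun h ⟨w⁻¹, hw1⟩) a) b
      rw [ev, ev] at this
      simpa using this
  have e2 := (key G a b).eq_formalMultilinearSeries_of_eventually (key H a b) e1
  have e3 := congrFun (FormalMultilinearSeries.ofScalars_series_injective ℂ ℂ e2) i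
  exact e3

/-- On `H₂` the extended norm is the Hilbert space norm. -/
theorem h2Norm_eval {p q : ℕ} (G : H2 p q) : h2Norm (H2.eval G) = ‖G‖ₑ := by
  refine le_antisymm (iInf_le_of_le G (iInf_le_of_le rfl le_rfl)) (le_iInf₂ fun H hH => ?_)
  rw [H2.eval_injective p q hH]

/-- `G ∈ z⁻ᵏ H₂` if and only if `G(z) = z⁻ᵏ H(z)` for some `H ∈ H₂`. -/
theorem mem_delayedH2_iff {p q k : ℕ} (G : H2 p q) :
    G ∈ delayedH2 p q k ↔
      ∃ H : H2 p q, ∀ z : ExtDisc, H2.eval G z = ((z : ℂ)⁻¹) ^ k • H2.eval H z := by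
  have up : ∀ H : H2 p q, ∃ S ∈ delayedH2 p q k, (∀ i, S (i + k) = H i) ∧
      ∀ z : ExtDisc, H2.eval S z = ((z : ℂ)⁻¹) ^ k • H2.eval H z := by
    intro H
    let f : ℕ → EuclideanSpace ℂ (Fin p × Fin q) := fun i => if i < k then 0 else H (i - k)
    have hk : ∀ i, f (i + k) = H i := fun i => by simp [f]
    have h0 : ∀ i < k, f i = 0 := fun i hi => by simp [f, hi]
    have hf : Memℓp f 2 := by
      have h2 := lp.memℓp H
      rw [memℓp_gen_iff (by norm_num)] at h2 ⊢
      refine (summable_nat_add_iff k).1 ?_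
      simpa only [hk] using h2
    refine ⟨⟨f, hf⟩, h0, hk, fun z => ?_⟩
    have h1 := ((H2.hasSum_eval H z).const_smul (((z : ℂ)⁻¹) ^ k))
    refine (H2.hasSum_eval ⟨f, hf⟩ z).unique ?_
    rw [← hasSum_nat_add_iff' k, Finset.sum_eq_zero, sub_zero]
    · have e : (fun i : ℕ => ((z : ℂ)⁻¹) ^ k • ((z : ℂ)⁻¹) ^ i • H2.coeff H i) =
          fun i => ((z : ℂ)⁻¹) ^ (i + k) • H2.coeff (⟨f, hf⟩ : H2 p q) (i + k) := by
        funext i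
        rw [smul_smul, ← pow_add, add_comm k i]
        congr 1
        ext a b
        exact (congrArg (fun v : EuclideanSpace ℂ (Fin p × Fin q) => v (a, b)) (hk i)).symm
      rw [e] at h1
      exact h1
    · intro i hi
      have : H2.coeff (⟨f, hf⟩ : H2 p q) i = 0 := by
        ext a b
        exact congrArg (fun v : EuclideanSpace ℂ (Fin p × Fin q) => v (a, b))
          (h0 i (Finset.mem_range.1 hi))
      rw [this, smul_zero]
  constructor
  · intro hG
    have hf : Memℓp (fun i => G (i + k)) 2 := by
      have h2 := lp.memℓp G
      rw [memℓp_gen_iff (by norm_num)] at h2 ⊢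
      exact (summable_nat_add_iff k).2 h2
    obtain ⟨S, hS, hSk, hSe⟩ := up ⟨fun i => G (i + k), hf⟩
    refine ⟨⟨fun i => G (i + k), hf⟩, fun z => ?_⟩
    have : G = S := by
      refine lp.ext (funext fun i => ?_)
      rcases lt_or_ge i k with hi | hi
      · rw [hG i hi, hS i hi]
      · obtain ⟨j, rfl⟩ := Nat.exists_eq_add_of_le' hi
        exact (hSk j).symm
    rw [← hSe z, ← this]
  · rintro ⟨H, hH⟩
    obtain ⟨S, hS, -, hSe⟩ := up H
    have : G = S := H2.eval_injective p q (funext fun z => by rw [hH, hSe])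
    rw [this]
    exact hS

/-- Real matrices seen as complex matrices. -/
abbrev toC {p q : ℕ} (M : Matrix (Fin p) (Fin q) ℝ) : Matrix (Fin p) (Fin q) ℂ :=
  M.map Complex.ofReal

/-- The transfer function `C (z I - A)⁻¹ B + D` of a real state space realization. -/
def stateSpace {n p q : ℕ} (A : Matrix (Fin n) (Fin n) ℝ) (B : Matrix (Fin n) (Fin q) ℝ)
    (C : Matrix (Fin p) (Fin n) ℝ) (D : Matrix (Fin p) (Fin q) ℝ) : TransferFun p q := fun z =>
  toC C * ((z : ℂ) • (1 : Matrix (Fin n) (Fin n) ℂ) - toC A)⁻¹ * toC B + toC D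

/-- All complex eigenvalues lie in the open unit disc. -/
def IsStable {n : ℕ} (A : Matrix (Fin n) (Fin n) ℝ) : Prop :=
  ∀ μ ∈ spectrum ℂ (toC A), ‖μ‖ < 1

/-- The matrices of a discrete time plant with state dimension `n`, inputs of dimension
`p₁, p₂` and outputs of dimension `q₁, q₂`. -/
structure Plant (n p₁ p₂ q₁ q₂ : ℕ) where
  A : Matrix (Fin n) (Fin n) ℝ
  B₁ : Matrix (Fin n) (Fin p₁) ℝ
  B₂ : Matrix (Fin n) (Fin p₂) ℝ
  C₁ : Matrix (Fin q₁) (Fin n) ℝ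
  C₂ : Matrix (Fin q₂) (Fin n) ℝ
  D₁₂ : Matrix (Fin q₁) (Fin p₂) ℝ
  D₂₁ : Matrix (Fin q₂) (Fin p₁) ℝ

namespace Plant

variable {n p₁ p₂ q₁ q₂ : ℕ} (P : Plant n p₁ p₂ q₁ q₂)

def P₁₁ : TransferFun q₁ p₁ := stateSpace P.A P.B₁ P.C₁ 0

def P₁₂ : TransferFun q₁ p₂ := stateSpace P.A P.B₂ P.C₁ P.D₁₂

def P₂₁ : TransferFun q₂ p₁ := stateSpace P.A P.B₁ P.C₂ P.D₂₁

def Ω (X : Matrix (Fin n) (Fin n) ℝ) : Matrix (Fin p₂) (Fin p₂) ℝ :=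
  P.D₁₂ᵀ * P.D₁₂ + P.B₂ᵀ * X * P.B₂

/-- The linear quadratic regulator gain. -/
def K (X : Matrix (Fin n) (Fin n) ℝ) : Matrix (Fin p₂) (Fin n) ℝ :=
  -((P.Ω X)⁻¹ * (P.B₂ᵀ * X * P.A + P.D₁₂ᵀ * P.C₁))

/-- `X` is a stabilizing solution of the control Riccati equation. -/
structure IsControlRiccatiSolution (X : Matrix (Fin n) (Fin n) ℝ) : Prop where
  isSymm : X.IsSymm
  isUnit : IsUnit (P.Ω X)
  eq : X = P.C₁ᵀ * P.C₁ + P.Aᵀ * X * P.A -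
    (P.Aᵀ * X * P.B₂ + P.C₁ᵀ * P.D₁₂) * (P.Ω X)⁻¹ * (P.B₂ᵀ * X * P.A + P.D₁₂ᵀ * P.C₁)
  stable : IsStable (P.A + P.B₂ * P.K X)

def Ψ (Y : Matrix (Fin n) (Fin n) ℝ) : Matrix (Fin q₂) (Fin q₂) ℝ :=
  P.D₂₁ * P.D₂₁ᵀ + P.C₂ * Y * P.C₂ᵀ

/-- The Kalman filter gain. -/
def L (Y : Matrix (Fin n) (Fin n) ℝ) : Matrix (Fin n) (Fin q₂) ℝ :=
  -((P.A * Y * P.C₂ᵀ + P.B₁ * P.D₂₁ᵀ) * (P.Ψ Y)⁻¹)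

/-- `Y` is a stabilizing solution of the estimation Riccati equation. -/
structure IsEstimationRiccatiSolution (Y : Matrix (Fin n) (Fin n) ℝ) : Prop where
  isSymm : Y.IsSymm
  isUnit : IsUnit (P.Ψ Y)
  eq : Y = P.B₁ * P.B₁ᵀ + P.A * Y * P.Aᵀ -
    (P.A * Y * P.C₂ᵀ + P.B₁ * P.D₂₁ᵀ) * (P.Ψ Y)⁻¹ * (P.C₂ * Y * P.Aᵀ + P.D₂₁ * P.B₁ᵀ)
  stable : IsStable (P.A + P.L Y * P.C₂)

/-- The left spectral factor `W_L`; `CFC.sqrt` is the positive semidefinite square root. -/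
def WL (X : Matrix (Fin n) (Fin n) ℝ) : TransferFun p₂ p₂ := fun z =>
  stateSpace (P.A + P.B₂ * P.K X) P.B₂ (P.K X) 1 z * toC (CFC.sqrt (P.Ω X))⁻¹

/-- The right spectral factor `W_R`. -/
def WR (Y : Matrix (Fin n) (Fin n) ℝ) : TransferFun q₂ q₂ := fun z =>
  toC (CFC.sqrt (P.Ψ Y))⁻¹ * stateSpace (P.A + P.L Y * P.C₂) (P.L Y) P.C₂ 1 z

/-- The transfer function `T = Ω^{1/2} K (z I - A)⁻¹ L Ψ^{1/2}`. -/
def T (X Y : Matrix (Fin n) (Fin n) ℝ) : TransferFun p₂ q₂ := fun z =>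
  toC (CFC.sqrt (P.Ω X)) * stateSpace P.A (P.L Y) (P.K X) 0 z * toC (CFC.sqrt (P.Ψ Y))

/-- The function `P₁₁ + P₁₂ Q P₂₁`. -/
def closedLoop (Q : H2 p₂ q₂) : TransferFun q₁ p₁ := fun z =>
  P.P₁₁ z + P.P₁₂ z * H2.eval Q z * P.P₂₁ z

/-- `Q` minimizes `‖P₁₁ + P₁₂ Q P₂₁‖` over the subspace `z⁻ᵏ H₂`. -/
def IsDelayedOptimal (k : ℕ) (Q : H2 p₂ q₂) : Prop :=
  Q ∈ delayedH2 p₂ q₂ k ∧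
    ∀ Q' ∈ delayedH2 p₂ q₂ k, h2Norm (P.closedLoop Q) ≤ h2Norm (P.closedLoop Q')

end Plant

end ModelMatching

end

/-! The squared cost is computed in the time domain, by completing the square twice. The function
`P₁₁ + P₁₂ U` with `U = Q P₂₁` is the output of a regulator loop: an impulse `B₁` enters at time 0,
and the input `U` vanishes at time 0. By the Riccati equation for `X`, the output energy at each
later time is the drop of `xᴴ X x` plus the energy of `Ω^{1/2} (u - K x)` (`complete_square`). The
drops telescope and the terminal term tends to 0, because the state is square summable. Hence
(`exists_energy_eq`) the squared norm is a constant plus `‖V‖²`, where `V = W_L⁻¹ U - Ω^{1/2} K (zI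
- A)⁻¹ B₁`.

The transpose of `V` is again the output of a regulator loop, now for the transposed plant, with
input `(W_L⁻¹ Q)ᵀ`. The same identity, with `Y` in place of `X`, turns the cost into a constant plus
`‖T + W_L⁻¹ Q W_R⁻¹‖²` (`exists_norm_closedLoop_sq_eq`). No boundary values on the circle and no
anticausal factors are needed.

Since `A`, `A + B₂ K` and `A + L C₂` are stable, the factors `W_L`, `W_R` and their inverses
preserve `H₂`. Multiplication commutes with `z⁻ᵏ`, so `Q ↦ W_L⁻¹ Q W_R⁻¹` is a bijection of `z⁻ᵏ H₂`
onto itself. What remains is the best approximation of `-T` in a closed subspace: its only solution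
is minus the orthogonal projection of `T`, and the bijection carries it back to `Q_N`. -/

noncomputable section

namespace ModelMatching

/-! ### Complexified real matrices and powers of stable matrices -/

section Matrices

variable {m n p q : ℕ}

theorem toC_mul (M : Matrix (Fin m) (Fin n) ℝ) (N : Matrix (Fin n) (Fin p) ℝ) :
    toC (M * N) = toC M * toC N :=
  Matrix.map_mul (f := Complex.ofRealHom)

theorem toC_add (M N : Matrix (Fin m) (Fin n) ℝ) : toC (M + N) = toC M + toC N :=
  Matrix.map_add _ Complex.ofReal_add M N

theorem toC_sub (M N : Matrix (Fin m) (Fin n) ℝ) : toC (M - N) = toC M - toC N :=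
  Matrix.map_sub _ Complex.ofReal_sub M N

theorem toC_neg (M : Matrix (Fin m) (Fin n) ℝ) : toC (-M) = -toC M := by
  ext; simp

theorem toC_zero : toC (0 : Matrix (Fin m) (Fin n) ℝ) = 0 := by
  ext; simp

theorem toC_one : toC (1 : Matrix (Fin n) (Fin n) ℝ) = 1 :=
  Matrix.map_one _ Complex.ofReal_zero Complex.ofReal_one

theorem toC_transpose (M : Matrix (Fin m) (Fin n) ℝ) : toC Mᵀ = (toC M)ᵀ := rfl

theorem conjTranspose_toC (M : Matrix (Fin m) (Fin n) ℝ) : (toC M)ᴴ = toC Mᵀ := by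
  ext; simp

theorem IsStable.transpose {A : Matrix (Fin n) (Fin n) ℝ} (hA : IsStable A) : IsStable Aᵀ := by
  intro μ hμ
  refine hA μ fun h => hμ ?_
  have := (Matrix.isUnit_transpose (A := algebraMap ℂ _ μ - toC A)).2 h
  rw [spectrum.mem_resolventSet_iff]
  rwa [Matrix.transpose_sub, Matrix.algebraMap_eq_diagonal, Matrix.diagonal_transpose] at this

/-- The pencil `z I - A` is invertible outside the unit disc if `A` is stable. -/
theorem IsStable.isUnit_det {A : Matrix (Fin n) (Fin n) ℝ} (hA : IsStable A) (z : ExtDisc) :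
    IsUnit ((z : ℂ) • (1 : Matrix (Fin n) (Fin n) ℂ) - toC A).det := by
  rw [← Matrix.isUnit_iff_isUnit_det, ← Algebra.algebraMap_eq_smul_one]
  by_contra h
  exact absurd (hA z h) (not_lt.2 z.2.le)

theorem norm_apply_le_linftyOpNorm (M : Matrix (Fin m) (Fin n) ℂ) (a : Fin m) (b : Fin n) :
    ‖M a b‖ ≤ @norm _ Matrix.linftyOpNormedAddCommGroup.toNorm M := by
  rw [Matrix.linfty_opNorm_def]
  have h1 : ‖M a b‖₊ ≤ ∑ j, ‖M a j‖₊ :=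
    Finset.single_le_sum (f := fun j => ‖M a j‖₊) (fun _ _ => zero_le) (Finset.mem_univ b)
  have h2 : ∑ j, ‖M a j‖₊ ≤ Finset.univ.sup fun i => ∑ j, ‖M i j‖₊ :=
    Finset.le_sup (f := fun i => ∑ j, ‖M i j‖₊) (Finset.mem_univ a)
  exact_mod_cast h1.trans h2

/-- The entries of the powers of a stable matrix are summable. -/
theorem IsStable.summable_pow {A : Matrix (Fin n) (Fin n) ℝ} (hA : IsStable A) (a b : Fin n) :
    Summable fun k : ℕ => ‖(toC A ^ k) a b‖ := by
  rcases Nat.eq_zero_or_pos n with rfl | hn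
  · exact a.elim0
  have : Nonempty (Fin n) := ⟨a⟩
  let _ : NormedRing (Matrix (Fin n) (Fin n) ℂ) := Matrix.linftyOpNormedRing
  let _ : NormedAlgebra ℂ (Matrix (Fin n) (Fin n) ℂ) := Matrix.linftyOpNormedAlgebra
  -- Gelfand's formula: the `k`-th roots of the norms of the powers tend to the spectral radius, so
  -- the powers are eventually bounded by `r ^ k` with some `r < 1`.
  have hr : spectralRadius ℂ (toC A) < 1 :=
    spectrum.spectralRadius_lt_of_forall_lt (toC A) (r := 1) fun k hk => hA k hk
  obtain ⟨r, hr1, hr2⟩ := ENNReal.lt_iff_exists_nnreal_btwn.1 hr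
  have hev := (spectrum.pow_nnnorm_pow_one_div_tendsto_nhds_spectralRadius
    (toC A)).eventually_lt_const hr1
  have hr2 : (r : ℝ) < 1 := by exact_mod_cast hr2
  refine Summable.of_norm_bounded_eventually_nat (g := fun k => (r : ℝ) ^ k)
    (summable_geometric_of_lt_one r.2 hr2) ?_
  filter_upwards [hev, Filter.eventually_gt_atTop 0] with k hk hk0
  have h1 : ‖toC A ^ k‖₊ ≤ r ^ k := by
    have h := ENNReal.rpow_le_rpow hk.le (Nat.cast_nonneg k : (0 : ℝ) ≤ k)
    rw [← ENNReal.rpow_mul, one_div_mul_cancel (by positivity), ENNReal.rpow_one,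
      ENNReal.rpow_natCast] at h
    exact_mod_cast h
  rw [norm_norm]
  exact (norm_apply_le_linftyOpNorm _ a b).trans (by exact_mod_cast h1)

end Matrices

/-! ### Square summable scalar sequences -/

section Sequences

theorem memℓp_two_iff {φ : ℕ → ℂ} : Memℓp φ 2 ↔ Summable fun i => ‖φ i‖ ^ 2 := by
  rw [memℓp_gen_iff (by norm_num)]
  simp

theorem memℓp_two_nat_add_iff {φ : ℕ → ℂ} (k : ℕ) :
    Memℓp (fun i => φ (i + k)) 2 ↔ Memℓp φ 2 := by
  rw [memℓp_two_iff, memℓp_two_iff]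
  exact summable_nat_add_iff (f := fun i => ‖φ i‖ ^ 2) k

theorem Memℓp.sum_mul {p : ℕ} (c : Fin p → ℂ) {φ : Fin p → ℕ → ℂ}
    (h : ∀ j, Memℓp (φ j) 2) : Memℓp (fun i => ∑ j, c j * φ j i) 2 := by
  exact Memℓp.finsetSum (E := fun _ : ℕ => ℂ) Finset.univ
    fun j _ => ((h j).const_smul (c j) : Memℓp (fun i => c j * φ j i) 2)

/-- Young's inequality: the convolution of a summable and a square summable sequence is square
summable. -/
theorem memℓp_two_convolution {α φ : ℕ → ℂ} (hα : Summable fun i => ‖α i‖) (hφ : Memℓp φ 2) :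
    Memℓp (fun k => ∑ x ∈ Finset.HasAntidiagonal.antidiagonal k, α x.1 * φ x.2) 2 := by
  rw [memℓp_two_iff] at hφ ⊢
  have hs := summable_norm_sum_mul_antidiagonal_of_summable_norm
    (f := fun i => ‖α i‖) (g := fun i => ‖φ i‖ ^ 2) (by simpa using hα) (by simpa using hφ)
  refine Summable.of_nonneg_of_le (fun _ => by positivity) (fun k => ?_)
    (hs.mul_left (∑' i, ‖α i‖))
  have h1 : ‖∑ x ∈ Finset.HasAntidiagonal.antidiagonal k, α x.1 * φ x.2‖ ≤
      ∑ x ∈ Finset.HasAntidiagonal.antidiagonal k, ‖α x.1‖ * ‖φ x.2‖ :=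
    (norm_sum_le _ _).trans (Finset.sum_le_sum fun x _ => (norm_mul _ _).le)
  -- Cauchy–Schwarz with one factor `‖α‖` kept as a weight: `(‖α‖ ‖φ‖)² = ‖α‖ · (‖α‖ ‖φ‖²)`. The
  -- second sum is then a Cauchy product of two summable sequences.
  have h2 : (∑ x ∈ Finset.HasAntidiagonal.antidiagonal k, ‖α x.1‖ * ‖φ x.2‖) ^ 2 ≤
      (∑ x ∈ Finset.HasAntidiagonal.antidiagonal k, ‖α x.1‖) *
        ∑ x ∈ Finset.HasAntidiagonal.antidiagonal k, ‖α x.1‖ * ‖φ x.2‖ ^ 2 :=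
    Finset.sum_sq_le_sum_mul_sum_of_sq_le_mul _ (fun _ _ => by positivity)
      (fun _ _ => by positivity) fun _ _ => le_of_eq (by ring)
  have h3 : ∑ x ∈ Finset.HasAntidiagonal.antidiagonal k, ‖α x.1‖ ≤ ∑' i, ‖α i‖ := by
    rw [Finset.Nat.sum_antidiagonal_eq_sum_range_succ_mk]
    exact hα.sum_le_tsum _ fun _ _ => norm_nonneg _
  calc ‖∑ x ∈ Finset.HasAntidiagonal.antidiagonal k, α x.1 * φ x.2‖ ^ 2
      ≤ (∑ x ∈ Finset.HasAntidiagonal.antidiagonal k, ‖α x.1‖ * ‖φ x.2‖) ^ 2 := by gcongr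
    _ ≤ _ := h2
    _ ≤ (∑' i, ‖α i‖) * ∑ x ∈ Finset.HasAntidiagonal.antidiagonal k, ‖α x.1‖ * ‖φ x.2‖ ^ 2 := by gcongr
    _ ≤ _ := mul_le_mul_of_nonneg_left (le_abs_self _) (tsum_nonneg fun _ => norm_nonneg _)

end Sequences

/-! ### Coefficientwise operations on `H₂` -/

namespace H2

variable {m n p q : ℕ}

theorem coeff_add (G H : H2 p q) (i : ℕ) : coeff (G + H) i = coeff G i + coeff H i := by
  ext; simp [coeff]

theorem coeff_sub (G H : H2 p q) (i : ℕ) : coeff (G - H) i = coeff G i - coeff H i := by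
  ext; simp [coeff]

theorem coeff_eq_zero_iff (G : H2 p q) (i : ℕ) : coeff G i = 0 ↔ G i = 0 := by
  constructor
  · intro h
    ext ⟨a, b⟩
    exact congrFun (congrFun h a) b
  · intro h
    ext a b
    simp [coeff, h]

theorem memℓp_coeff (G : H2 p q) (a : Fin p) (b : Fin q) :
    Memℓp (fun i => coeff G i a b) 2 := by
  have h := lp.memℓp G
  rw [memℓp_two_iff]
  rw [memℓp_gen_iff (by norm_num)] at h
  refine Summable.of_nonneg_of_le (fun _ => by positivity) (fun i => ?_)
    (h.congr fun i => by simp : Summable fun i => ‖G i‖ ^ 2)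
  gcongr
  exact PiLp.norm_apply_le (G i) (a, b)

/-- The element of `H₂` with given square summable coefficients. -/
def ofCoeff (g : ℕ → Matrix (Fin p) (Fin q) ℂ)
    (hg : ∀ a b, Memℓp (fun i => g i a b) 2) : H2 p q :=
  ⟨fun i => WithLp.toLp 2 fun x => g i x.1 x.2, by
    refine memℓp_gen ?_
    have h : Summable fun i => ∑ x : Fin p × Fin q, ‖g i x.1 x.2‖ ^ 2 :=
      summable_sum fun x _ => memℓp_two_iff.1 (hg x.1 x.2)
    refine h.congr fun i => ?_
    have := EuclideanSpace.norm_sq_eq (WithLp.toLp 2 fun x : Fin p × Fin q => g i x.1 x.2)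
    simpa using this.symm⟩

@[simp]
theorem coeff_ofCoeff (g : ℕ → Matrix (Fin p) (Fin q) ℂ)
    (hg : ∀ a b, Memℓp (fun i => g i a b) 2) (i : ℕ) : coeff (ofCoeff g hg) i = g i :=
  rfl

theorem hasSum_eval_apply (G : H2 p q) (z : ExtDisc) (a : Fin p) (b : Fin q) :
    HasSum (fun i : ℕ => ((z : ℂ)⁻¹) ^ i * coeff G i a b) (eval G z a b) := by
  simpa using Pi.hasSum.1 (Pi.hasSum.1 (hasSum_eval G z) a) b

theorem eval_eq_of_hasSum {G : H2 p q} {z : ExtDisc} {M : Matrix (Fin p) (Fin q) ℂ}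
    (h : ∀ a b, HasSum (fun i : ℕ => ((z : ℂ)⁻¹) ^ i * coeff G i a b) (M a b)) :
    eval G z = M := by
  ext a b
  exact (hasSum_eval_apply G z a b).unique (h a b)

theorem eval_add (G H : H2 p q) (z : ExtDisc) : eval (G + H) z = eval G z + eval H z := by
  refine eval_eq_of_hasSum fun a b => ?_
  simpa [coeff_add, mul_add] using (hasSum_eval_apply G z a b).add (hasSum_eval_apply H z a b)

theorem eval_neg (G : H2 p q) (z : ExtDisc) : eval (-G) z = -eval G z := by
  refine eval_eq_of_hasSum fun a b => ?_
  simpa [coeff] using (hasSum_eval_apply G z a b).neg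

theorem eval_sub (G H : H2 p q) (z : ExtDisc) : eval (G - H) z = eval G z - eval H z := by
  rw [sub_eq_add_neg, eval_add, eval_neg, sub_eq_add_neg]

/-- A constant matrix as an element of `H₂`. -/
def const (M : Matrix (Fin p) (Fin q) ℂ) : H2 p q :=
  ofCoeff (fun i => if i = 0 then M else 0) fun a b => by
    rw [← memℓp_two_nat_add_iff 1]
    simp [memℓp_two_iff]

theorem coeff_const (M : Matrix (Fin p) (Fin q) ℂ) (i : ℕ) :
    coeff (const M) i = if i = 0 then M else 0 :=
  rfl

theorem eval_const (M : Matrix (Fin p) (Fin q) ℂ) (z : ExtDisc) : eval (const M) z = M := by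
  refine eval_eq_of_hasSum fun a b => ?_
  convert! hasSum_ite_eq 0 (M a b) using 2 with i
  by_cases hi : i = 0 <;> simp [coeff_const, hi]

/-- Multiplication by a constant matrix from the left. -/
def constMul (M : Matrix (Fin m) (Fin p) ℂ) (G : H2 p q) : H2 m q :=
  ofCoeff (fun i => M * coeff G i) fun a b => by
    simpa only [Matrix.mul_apply] using Memℓp.sum_mul (M a) fun j => memℓp_coeff G j b

theorem coeff_constMul (M : Matrix (Fin m) (Fin p) ℂ) (G : H2 p q) (i : ℕ) :
    coeff (constMul M G) i = M * coeff G i :=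
  rfl

theorem eval_constMul (M : Matrix (Fin m) (Fin p) ℂ) (G : H2 p q) (z : ExtDisc) :
    eval (constMul M G) z = M * eval G z := by
  refine eval_eq_of_hasSum fun a b => ?_
  simp only [coeff_constMul, Matrix.mul_apply, Finset.mul_sum]
  refine hasSum_sum fun j _ => ?_
  simpa [mul_left_comm] using (hasSum_eval_apply G z j b).mul_left (M a j)

/-- The transpose of an element of `H₂`. -/
def transpose (G : H2 p q) : H2 q p :=
  ofCoeff (fun i => (coeff G i)ᵀ) fun a b => memℓp_coeff G b a

theorem coeff_transpose (G : H2 p q) (i : ℕ) : coeff (transpose G) i = (coeff G i)ᵀ :=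
  rfl

theorem eval_transpose (G : H2 p q) (z : ExtDisc) : eval (transpose G) z = (eval G z)ᵀ :=
  eval_eq_of_hasSum fun a b => hasSum_eval_apply G z b a

/-- This invariance is what lets the estimation problem be treated as a control problem for the
transposed plant. -/
theorem norm_transpose (G : H2 p q) : ‖transpose G‖ = ‖G‖ := by
  rw [← sq_eq_sq₀ (norm_nonneg _) (norm_nonneg _), norm_sq, norm_sq]
  refine tsum_congr fun i => congrArg Complex.re ?_
  rw [coeff_transpose, Matrix.trace, Matrix.trace]
  simp only [Matrix.diag_apply, Matrix.mul_apply, Matrix.transpose_apply,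
    Matrix.conjTranspose_apply]
  exact Finset.sum_comm

/-- Applied to the state, this removes the terminal cost from the telescoping energy sum. -/
theorem tendsto_coeff (G : H2 p q) :
    Filter.Tendsto (fun i => coeff G i) Filter.atTop (nhds 0) := by
  refine tendsto_pi_nhds.2 fun a => tendsto_pi_nhds.2 fun b => ?_
  have h := (memℓp_two_iff.1 (memℓp_coeff G a b)).tendsto_atTop_zero
  refine tendsto_zero_iff_norm_tendsto_zero.2 ?_
  simpa using h.sqrt

end H2

/-! ### Stable systems acting on `H₂` -/

/-- The response of a stable system to a square summable input is square summable. -/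
theorem IsStable.exists_state {n q : ℕ} {A : Matrix (Fin n) (Fin n) ℝ} (hA : IsStable A)
    (F : H2 n q) :
    ∃ x : H2 n q, H2.coeff x 0 = 0 ∧
      (∀ k, H2.coeff x (k + 1) = toC A * H2.coeff x k + H2.coeff F k) ∧
      ∀ z : ExtDisc, H2.eval x z = ((z : ℂ) • 1 - toC A)⁻¹ * H2.eval F z := by
  let s : ℕ → Matrix (Fin n) (Fin q) ℂ := fun k =>
    ∑ x ∈ Finset.HasAntidiagonal.antidiagonal k, toC A ^ x.1 * H2.coeff F x.2
  -- Variation of constants: the state is the convolution of the powers of `A` with the input,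
  -- delayed by one step so that it starts at 0.
  let g : ℕ → Matrix (Fin n) (Fin q) ℂ := fun k => Nat.casesOn k 0 s
  have hs : ∀ k, s (k + 1) = toC A * s k + H2.coeff F (k + 1) := by
    intro k
    simp only [s, Finset.Nat.sum_antidiagonal_succ, Matrix.mul_sum, pow_zero,
      Matrix.one_mul, pow_succ', Matrix.mul_assoc]
    rw [add_comm]
  have hg : ∀ a b, Memℓp (fun i => g i a b) 2 := by
    intro a b
    rw [← memℓp_two_nat_add_iff 1]
    have h : ∀ c, Memℓp (fun k => ∑ x ∈ Finset.HasAntidiagonal.antidiagonal k,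
        (toC A ^ x.1) a c * H2.coeff F x.2 c b) 2 := fun c =>
      memℓp_two_convolution (α := fun i => (toC A ^ i) a c)
        (φ := fun i => H2.coeff F i c b) (hA.summable_pow a c) (H2.memℓp_coeff F c b)
    have h' := Memℓp.sum_mul (fun _ => 1) h
    have e : ∀ k, g (k + 1) a b = ∑ c, 1 * ∑ x ∈ Finset.HasAntidiagonal.antidiagonal k,
        (toC A ^ x.1) a c * H2.coeff F x.2 c b := by
      intro k
      change s k a b = _
      simp only [s, Matrix.sum_apply, Matrix.mul_apply, one_mul]
      exact Finset.sum_comm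
    simpa only [e] using h'
  have hrec : ∀ k, g (k + 1) = toC A * g k + H2.coeff F k := by
    rintro (_ | k)
    · simp [g, s]
    · exact hs k
  refine ⟨H2.ofCoeff g hg, rfl, hrec, fun z => ?_⟩
  set x := H2.ofCoeff g hg with hx
  have hz : (z : ℂ) ≠ 0 := fun h => by
    have := z.2
    rw [h, norm_zero] at this
    linarith
  -- Multiplication by `z` shifts the coefficients down by one; nothing is lost, because the
  -- coefficient at time 0 vanishes.
  have key : (z : ℂ) • H2.eval x z = toC A * H2.eval x z + H2.eval F z := by
    rw [← H2.eval_constMul, ← H2.eval_add]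
    ext a b
    have h1 := (hasSum_nat_add_iff' 1).2 ((H2.hasSum_eval_apply x z a b).mul_left (z : ℂ))
    have h2 := H2.hasSum_eval_apply (H2.constMul (toC A) x + F) z a b
    have e : ∀ k, (z : ℂ) * ((z : ℂ)⁻¹ ^ (k + 1) * H2.coeff x (k + 1) a b) =
        (z : ℂ)⁻¹ ^ k * H2.coeff (H2.constMul (toC A) x + F) k a b := by
      intro k
      rw [H2.coeff_add, H2.coeff_constMul]
      change (z : ℂ) * ((z : ℂ)⁻¹ ^ (k + 1) * g (k + 1) a b) = _
      rw [hrec k, pow_succ]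
      field_simp
      rfl
    simp only [e] at h1
    have h3 := h1.unique h2
    rw [← h3]
    simp [hx, g]
  have key2 : ((z : ℂ) • 1 - toC A) * H2.eval x z = H2.eval F z := by
    rw [Matrix.sub_mul, Matrix.smul_mul, Matrix.one_mul, key, add_sub_cancel_left]
  rw [← key2, Matrix.nonsing_inv_mul_cancel_left _ _ (hA.isUnit_det z)]

section IsH2

variable {m n p q : ℕ}

theorem IsH2.add {F G : TransferFun p q} (hF : IsH2 F) (hG : IsH2 G) :
    IsH2 fun z => F z + G z := by
  obtain ⟨F, rfl⟩ := hF
  obtain ⟨G, rfl⟩ := hG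
  exact ⟨F + G, funext fun z => H2.eval_add F G z⟩

theorem IsH2.transpose {F : TransferFun p q} (hF : IsH2 F) : IsH2 fun z => (F z)ᵀ := by
  obtain ⟨F, rfl⟩ := hF
  exact ⟨F.transpose, funext fun z => H2.eval_transpose F z⟩

theorem isH2_const (M : Matrix (Fin p) (Fin q) ℂ) : IsH2 fun _ => M :=
  ⟨H2.const M, funext fun z => H2.eval_const M z⟩

theorem IsH2.const_mul (M : Matrix (Fin m) (Fin p) ℂ) {F : TransferFun p q} (hF : IsH2 F) :
    IsH2 fun z => M * F z := by
  obtain ⟨F, rfl⟩ := hF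
  exact ⟨H2.constMul M F, funext fun z => H2.eval_constMul M F z⟩

theorem IsH2.mul_const {F : TransferFun p q} (hF : IsH2 F) (M : Matrix (Fin q) (Fin m) ℂ) :
    IsH2 fun z => F z * M := by
  simpa [Matrix.transpose_mul] using (hF.transpose.const_mul Mᵀ).transpose

/-- The product is `C x + D F`, where `x` is the square summable state driven by `B F`. -/
theorem IsH2.stateSpace_mul {A : Matrix (Fin n) (Fin n) ℝ} (hA : IsStable A)
    (B : Matrix (Fin n) (Fin q) ℝ) (C : Matrix (Fin p) (Fin n) ℝ) (D : Matrix (Fin p) (Fin q) ℝ)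
    {F : TransferFun q m} (hF : IsH2 F) : IsH2 fun z => stateSpace A B C D z * F z := by
  obtain ⟨G, hG⟩ := hF.const_mul (toC B)
  obtain ⟨x, -, -, hx⟩ := hA.exists_state G
  have h := (IsH2.const_mul (toC C) ⟨x, rfl⟩).add (hF.const_mul (toC D))
  convert! h using 2 with z
  rw [hx, hG, stateSpace, Matrix.add_mul]
  simp only [Matrix.mul_assoc]

theorem transpose_stateSpace (A : Matrix (Fin n) (Fin n) ℝ) (B : Matrix (Fin n) (Fin q) ℝ)
    (C : Matrix (Fin p) (Fin n) ℝ) (D : Matrix (Fin p) (Fin q) ℝ) (z : ExtDisc) :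
    (stateSpace A B C D z)ᵀ = stateSpace Aᵀ Cᵀ Bᵀ Dᵀ z := by
  simp only [stateSpace, Matrix.transpose_add, Matrix.transpose_mul, toC_transpose,
    Matrix.transpose_nonsing_inv, Matrix.transpose_sub, Matrix.transpose_smul,
    Matrix.transpose_one, Matrix.mul_assoc]

theorem IsH2.mul_stateSpace {A : Matrix (Fin n) (Fin n) ℝ} (hA : IsStable A)
    (B : Matrix (Fin n) (Fin q) ℝ) (C : Matrix (Fin p) (Fin n) ℝ) (D : Matrix (Fin p) (Fin q) ℝ)
    {F : TransferFun m p} (hF : IsH2 F) : IsH2 fun z => F z * stateSpace A B C D z := by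
  have h := (IsH2.stateSpace_mul hA.transpose Cᵀ Bᵀ Dᵀ hF.transpose).transpose
  simpa [Matrix.transpose_mul, transpose_stateSpace] using h

theorem IsStable.isH2_stateSpace {A : Matrix (Fin n) (Fin n) ℝ} (hA : IsStable A)
    (B : Matrix (Fin n) (Fin q) ℝ) (C : Matrix (Fin p) (Fin n) ℝ)
    (D : Matrix (Fin p) (Fin q) ℝ) : IsH2 (stateSpace A B C D) := by
  simpa using IsH2.stateSpace_mul hA B C D (isH2_const (1 : Matrix (Fin q) (Fin q) ℂ))

end IsH2

/-! ### Riccati equations and the energy identity -/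

theorem H2.hasSum_norm_sq {p q : ℕ} (G : H2 p q) :
    HasSum (fun i => ((H2.coeff G i * (H2.coeff G i)ᴴ).trace).re) (‖G‖ ^ 2) := by
  have h := lp.hasSum_norm (p := 2) (by norm_num) G
  have e : ∀ i, ‖G i‖ ^ 2 = ((H2.coeff G i * (H2.coeff G i)ᴴ).trace).re := by
    intro i
    rw [EuclideanSpace.norm_sq_eq, Fintype.sum_prod_type, Matrix.trace, Complex.re_sum]
    refine Finset.sum_congr rfl fun a _ => ?_
    rw [Matrix.diag_apply, Matrix.mul_apply, Complex.re_sum]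
    refine Finset.sum_congr rfl fun b _ => ?_
    simp [H2.coeff, Complex.mul_conj, Complex.normSq_eq_norm_sq]
    norm_cast
  simp only [← e]
  simpa using h

/-- Completion of the square in the linear quadratic regulator problem. -/
theorem complete_square {R : Type*} [CommRing R] {n p q m l : ℕ} {A A' X : Matrix (Fin n) (Fin n) R}
    {B : Matrix (Fin n) (Fin p) R} {B' : Matrix (Fin p) (Fin n) R}
    {C : Matrix (Fin q) (Fin n) R} {C' : Matrix (Fin n) (Fin q) R}
    {D : Matrix (Fin q) (Fin p) R} {D' : Matrix (Fin p) (Fin q) R}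
    {W : Matrix (Fin p) (Fin p) R} {K : Matrix (Fin p) (Fin n) R} {K' : Matrix (Fin n) (Fin p) R}
    (hW : W = D' * D + B' * X * B) (hX : X = C' * C + A' * X * A - K' * W * K)
    (hK : W * K = -(B' * X * A + D' * C)) (hK' : K' * W = -(A' * X * B + C' * D))
    (x : Matrix (Fin n) (Fin m) R) (u : Matrix (Fin p) (Fin m) R)
    (x' : Matrix (Fin l) (Fin n) R) (u' : Matrix (Fin l) (Fin p) R) :
    (x' * C' + u' * D') * (C * x + D * u) + (x' * A' + u' * B') * X * (A * x + B * u) =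
      x' * X * x + (u' - x' * K') * W * (u - K * x) := by
  have h1 : (u' - x' * K') * W * (u - K * x) =
      u' * W * u - u' * (W * K) * x - x' * (K' * W) * u + x' * (K' * W * K) * x := by
    simp only [Matrix.mul_sub, Matrix.sub_mul, Matrix.mul_assoc]
    abel
  have h2 : x' * X * x = x' * (C' * C + A' * X * A - K' * W * K) * x := by rw [← hX]
  rw [h1, h2, hK, hK']
  conv_rhs => rw [hW]
  simp only [Matrix.mul_sub, Matrix.sub_mul, Matrix.mul_add, Matrix.add_mul, Matrix.mul_neg,
    Matrix.neg_mul, Matrix.mul_assoc]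
  abel

/-- A solution of a Stein equation with a stable matrix is positive semidefinite. -/
theorem IsStable.posSemidef_of_stein {n q : ℕ} {A X : Matrix (Fin n) (Fin n) ℝ}
    {C : Matrix (Fin q) (Fin n) ℝ} (hA : IsStable A) (hs : X.IsSymm)
    (hX : X = Cᵀ * C + Aᵀ * X * A) : X.PosSemidef := by
  refine Matrix.PosSemidef.of_dotProduct_mulVec_nonneg hs fun v => ?_
  have hpow : Filter.Tendsto (fun k => A ^ k) Filter.atTop (nhds 0) := by
    refine tendsto_pi_nhds.2 fun a => tendsto_pi_nhds.2 fun b => ?_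
    have h := (hA.summable_pow a b).tendsto_atTop_zero
    refine tendsto_zero_iff_norm_tendsto_zero.2 (h.congr fun k => ?_)
    have e : toC A ^ k = toC (A ^ k) := by
      induction k with
      | zero => simp
      | succ k ih => rw [pow_succ, pow_succ, toC_mul, ih]
    simp [e]
  -- Iterating the Stein equation writes this difference as the sum of `(C Aʲ)ᵀ (C Aʲ)` over `j <
  -- k`; as `k → ∞` it tends to `X`.
  have hstep : ∀ k : ℕ, (X - (A ^ k)ᵀ * X * A ^ k).PosSemidef := by
    intro k
    induction k with
    | zero => simpa using Matrix.PosSemidef.zero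
    | succ k ih =>
      have h : ((C * A ^ k)ᵀ * (C * A ^ k)).PosSemidef := by
        simpa using Matrix.posSemidef_conjTranspose_mul_self (C * A ^ k)
      have e : X - (A ^ (k + 1))ᵀ * X * A ^ (k + 1) =
          (X - (A ^ k)ᵀ * X * A ^ k) + (C * A ^ k)ᵀ * (C * A ^ k) := by
        have e1 : (A ^ k)ᵀ * X * A ^ k = (A ^ k)ᵀ * (Cᵀ * C + Aᵀ * X * A) * A ^ k := by
          rw [← hX]
        rw [e1, pow_succ', Matrix.transpose_mul, Matrix.transpose_mul]
        simp only [Matrix.mul_add, Matrix.add_mul, Matrix.mul_assoc]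
        abel
      rw [e]
      exact ih.add h
  have hlim : Filter.Tendsto (fun k => v ⬝ᵥ (X - (A ^ k)ᵀ * X * A ^ k) *ᵥ v) Filter.atTop
      (nhds (v ⬝ᵥ (X - (0 : Matrix (Fin n) (Fin n) ℝ)ᵀ * X * 0) *ᵥ v)) := by
    have hc : Continuous fun M : Matrix (Fin n) (Fin n) ℝ => v ⬝ᵥ (X - Mᵀ * X * M) *ᵥ v := by
      fun_prop
    exact (hc.tendsto 0).comp hpow
  simpa using ge_of_tendsto' hlim fun k => by simpa using (hstep k).dotProduct_mulVec_nonneg v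

theorem transpose_sqrt {p : ℕ} (M : Matrix (Fin p) (Fin p) ℝ) :
    (CFC.sqrt M)ᵀ = CFC.sqrt M := by
  simpa using (Matrix.nonneg_iff_posSemidef.1 (CFC.sqrt_nonneg M)).isHermitian.eq

namespace Plant

variable {n p₁ p₂ q₁ q₂ : ℕ} {P : Plant n p₁ p₂ q₁ q₂} {X Y : Matrix (Fin n) (Fin n) ℝ}

theorem transpose_Ω (hX : X.IsSymm) : (P.Ω X)ᵀ = P.Ω X := by
  simp [Ω, Matrix.transpose_mul, hX.eq, Matrix.mul_assoc]

theorem transpose_K (hX : X.IsSymm) :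
    (P.K X)ᵀ = -((P.Aᵀ * X * P.B₂ + P.C₁ᵀ * P.D₁₂) * (P.Ω X)⁻¹) := by
  simp [K, Matrix.transpose_mul, Matrix.transpose_nonsing_inv, transpose_Ω hX, hX.eq,
    Matrix.mul_assoc]

namespace IsControlRiccatiSolution

theorem isUnit_det (hX : P.IsControlRiccatiSolution X) : IsUnit (P.Ω X).det :=
  (Matrix.isUnit_iff_isUnit_det _).1 hX.isUnit

theorem Ω_mul_K (hX : P.IsControlRiccatiSolution X) :
    P.Ω X * P.K X = -(P.B₂ᵀ * X * P.A + P.D₁₂ᵀ * P.C₁) := by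
  rw [K, Matrix.mul_neg, Matrix.mul_nonsing_inv_cancel_left _ _ hX.isUnit_det]

theorem transpose_K_mul_Ω (hX : P.IsControlRiccatiSolution X) :
    (P.K X)ᵀ * P.Ω X = -(P.Aᵀ * X * P.B₂ + P.C₁ᵀ * P.D₁₂) := by
  rw [transpose_K hX.isSymm, Matrix.neg_mul, Matrix.nonsing_inv_mul_cancel_right _ _ hX.isUnit_det]

theorem eq_sub_gain (hX : P.IsControlRiccatiSolution X) :
    X = P.C₁ᵀ * P.C₁ + P.Aᵀ * X * P.A - (P.K X)ᵀ * P.Ω X * P.K X := by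
  rw [hX.transpose_K_mul_Ω, K, Matrix.neg_mul, Matrix.mul_neg, neg_neg, ← Matrix.mul_assoc]
  exact hX.eq

/-- Under the feedback `u = K x` the completed square vanishes, and the Riccati equation becomes a
Stein equation for the stable matrix `A + B₂ K` with output matrix `C₁ + D₁₂ K`. Positivity of `X`
makes `Ω` positive definite, so its square root is a genuine one. -/
theorem posSemidef (hX : P.IsControlRiccatiSolution X) : X.PosSemidef := by
  refine hX.stable.posSemidef_of_stein (C := P.C₁ + P.D₁₂ * P.K X) hX.isSymm ?_
  have h := complete_square rfl hX.eq_sub_gain hX.Ω_mul_K hX.transpose_K_mul_Ω 1 (P.K X) 1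
    (P.K X)ᵀ
  simp only [Matrix.mul_one, Matrix.one_mul, sub_self, Matrix.zero_mul, add_zero] at h
  simpa [Matrix.transpose_add, Matrix.transpose_mul] using h.symm

theorem posDef_Ω (hX : P.IsControlRiccatiSolution X)
    (hD : (P.D₁₂ᵀ * P.D₁₂).PosDef) : (P.Ω X).PosDef := by
  refine hD.add_posSemidef ?_
  simpa using hX.posSemidef.conjTranspose_mul_mul_same P.B₂

theorem sqrt_mul_sqrt (hX : P.IsControlRiccatiSolution X)
    (hD : (P.D₁₂ᵀ * P.D₁₂).PosDef) :
    CFC.sqrt (P.Ω X) * CFC.sqrt (P.Ω X) = P.Ω X :=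
  CFC.sqrt_mul_sqrt_self _ (hX.posDef_Ω hD).posSemidef.nonneg

theorem isUnit_det_sqrt (hX : P.IsControlRiccatiSolution X)
    (hD : (P.D₁₂ᵀ * P.D₁₂).PosDef) : IsUnit (CFC.sqrt (P.Ω X)).det := by
  have h := hX.isUnit_det
  rw [← hX.sqrt_mul_sqrt hD, Matrix.det_mul] at h
  exact isUnit_of_mul_isUnit_left h

end IsControlRiccatiSolution

/-- The inverse of the spectral factor `W_L`. -/
def WLInv (P : Plant n p₁ p₂ q₁ q₂) (X : Matrix (Fin n) (Fin n) ℝ) : TransferFun p₂ p₂ :=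
  fun z => toC (CFC.sqrt (P.Ω X)) * stateSpace P.A P.B₂ (-P.K X) 1 z

/-- The energy of the output of the closed loop system is, up to a constant, the energy of the
weighted deviation of the input from the optimal state feedback. -/
theorem IsControlRiccatiSolution.exists_energy_eq (hX : P.IsControlRiccatiSolution X)
    (hA : IsStable P.A) (hD : (P.D₁₂ᵀ * P.D₁₂).PosDef) {m : ℕ} (F : Matrix (Fin n) (Fin m) ℝ) :
    ∃ c : ℝ, ∀ (U : H2 p₂ m) (G : H2 q₁ m) (V : H2 p₂ m), U ∈ delayedH2 p₂ m 1 →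
      (∀ z, H2.eval G z = stateSpace P.A F P.C₁ 0 z + P.P₁₂ z * H2.eval U z) →
      (∀ z, H2.eval V z = P.WLInv X z * H2.eval U z -
        toC (CFC.sqrt (P.Ω X)) * stateSpace P.A F (P.K X) 0 z) →
      ‖G‖ ^ 2 = c + ‖V‖ ^ 2 := by
  -- The input vanishes at time 0, so the state at time 1 is `F` whatever `U` is; the constant is
  -- the value of the quadratic form of `X` there.
  refine ⟨((toC F)ᴴ * toC X * toC F).trace.re, fun U G V hU hG hV => ?_⟩
  set R := CFC.sqrt (P.Ω X) with hR
  obtain ⟨x, hx0, hx1, hxz⟩ := hA.exists_state (H2.const (toC F) + H2.constMul (toC P.B₂) U)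
  have hU0 : H2.coeff U 0 = 0 := (H2.coeff_eq_zero_iff U 0).2 (hU 0 one_pos)
  have hG' : G = H2.constMul (toC P.C₁) x + H2.constMul (toC P.D₁₂) U := by
    refine H2.eval_injective _ _ (funext fun z => ?_)
    rw [hG, H2.eval_add, H2.eval_constMul, H2.eval_constMul, hxz, H2.eval_add, H2.eval_constMul,
      H2.eval_const, P₁₂, stateSpace, stateSpace, toC_zero]
    simp only [Matrix.mul_add, Matrix.add_mul, Matrix.mul_assoc, add_zero]
    abel
  have hV' : V = H2.constMul (toC R) (U - H2.constMul (toC (P.K X)) x) := by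
    refine H2.eval_injective _ _ (funext fun z => ?_)
    rw [hV, H2.eval_constMul, H2.eval_sub, H2.eval_constMul, hxz, H2.eval_add, H2.eval_constMul,
      H2.eval_const, WLInv, stateSpace, stateSpace, toC_zero, toC_one, toC_neg, ← hR]
    simp only [Matrix.mul_add, Matrix.add_mul, Matrix.mul_sub, Matrix.mul_assoc, add_zero,
      Matrix.one_mul, Matrix.neg_mul, Matrix.mul_neg]
    abel
  let E : ℕ → ℝ := fun k => ((H2.coeff x k)ᴴ * toC X * H2.coeff x k).trace.re
  have hx1' : H2.coeff x 1 = toC F := by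
    rw [hx1 0, hx0, H2.coeff_add, H2.coeff_constMul, hU0, H2.coeff_const]
    simp
  -- The completed square at time `k + 1`, after taking traces: the energies of `G` and `V` differ
  -- by the decrease of `E`, which telescopes.
  have hstep : ∀ k, (H2.coeff G (k + 1) * (H2.coeff G (k + 1))ᴴ).trace.re -
      (H2.coeff V (k + 1) * (H2.coeff V (k + 1))ᴴ).trace.re = E (k + 1) - E (k + 1 + 1) := by
    intro k
    have hx2 : H2.coeff x (k + 1 + 1) =
        toC P.A * H2.coeff x (k + 1) + toC P.B₂ * H2.coeff U (k + 1) := by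
      rw [hx1 (k + 1), H2.coeff_add, H2.coeff_constMul, H2.coeff_const]
      simp
    have hsq := complete_square (A := toC P.A) (A' := toC P.Aᵀ) (X := toC X) (B := toC P.B₂)
      (B' := toC P.B₂ᵀ) (C := toC P.C₁) (C' := toC P.C₁ᵀ) (D := toC P.D₁₂) (D' := toC P.D₁₂ᵀ)
      (W := toC (P.Ω X)) (K := toC (P.K X)) (K' := toC (P.K X)ᵀ)
      (by simp only [Ω, toC_add, toC_mul])
      (by
        simp only [← toC_add, ← toC_mul, ← toC_sub]
        exact congrArg toC hX.eq_sub_gain)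
      (by simp only [← toC_add, ← toC_mul, ← toC_neg, hX.Ω_mul_K])
      (by simp only [← toC_add, ← toC_mul, ← toC_neg, hX.transpose_K_mul_Ω])
      (H2.coeff x (k + 1)) (H2.coeff U (k + 1)) (H2.coeff x (k + 1))ᴴ (H2.coeff U (k + 1))ᴴ
    have hRR : toC (P.Ω X) = (toC R)ᴴ * toC R := by
      rw [conjTranspose_toC, transpose_sqrt, ← toC_mul, hX.sqrt_mul_sqrt hD]
    have hsq' : (H2.coeff G (k + 1))ᴴ * H2.coeff G (k + 1) +
        (H2.coeff x (k + 1 + 1))ᴴ * toC X * H2.coeff x (k + 1 + 1) =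
        (H2.coeff x (k + 1))ᴴ * toC X * H2.coeff x (k + 1) +
        (H2.coeff V (k + 1))ᴴ * H2.coeff V (k + 1) := by
      rw [hx2, hG', hV', H2.coeff_constMul, H2.coeff_sub, H2.coeff_add, H2.coeff_constMul,
        H2.coeff_constMul, H2.coeff_constMul]
      rw [hRR] at hsq
      simpa only [Matrix.conjTranspose_add, Matrix.conjTranspose_sub, Matrix.conjTranspose_mul,
        conjTranspose_toC, Matrix.mul_assoc] using hsq
    have ht := congrArg (fun M => M.trace.re) hsq'
    simp only [Matrix.trace_add, Complex.add_re] at ht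
    rw [Matrix.trace_mul_comm (H2.coeff G (k + 1)), Matrix.trace_mul_comm (H2.coeff V (k + 1))]
    simp only [E]
    linarith
  have hE : Filter.Tendsto (fun k => E (k + 1)) Filter.atTop (nhds 0) := by
    have hc : Continuous fun M : Matrix (Fin n) (Fin m) ℂ => (Mᴴ * toC X * M).trace.re := by
      fun_prop
    have h := (hc.tendsto 0).comp ((Filter.tendsto_add_atTop_iff_nat 1).2 (H2.tendsto_coeff x))
    simpa [E, Function.comp_def] using h
  have h1 := ((hasSum_nat_add_iff' 1).2
    ((H2.hasSum_norm_sq G).sub (H2.hasSum_norm_sq V))).tendsto_sum_nat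
  simp only [hstep, Finset.sum_range_sub' fun k => E (k + 1)] at h1
  have h2 := tendsto_nhds_unique h1 (tendsto_const_nhds.sub hE)
  have hG0 : H2.coeff G 0 = 0 := by
    rw [hG', H2.coeff_add, H2.coeff_constMul, H2.coeff_constMul, hx0, hU0]
    simp
  have hV0 : H2.coeff V 0 = 0 := by
    rw [hV', H2.coeff_constMul, H2.coeff_sub, H2.coeff_constMul, hx0, hU0]
    simp
  have hE1 : E (0 + 1) = ((toC F)ᴴ * toC X * toC F).trace.re := by
    simp only [E, zero_add, hx1']
  simp only [Finset.sum_range_one, hG0, hV0, Matrix.zero_mul, Matrix.trace_zero, Complex.zero_re,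
    sub_zero] at h2
  linarith

end Plant

/-! ### Delays and the inverses of the spectral factors -/

/-- The scalar `z⁻ᵏ` commutes with both multipliers, so only preservation of `H₂` has to be known.
-/
theorem mem_delayedH2_of_eval_eq {p q r s k : ℕ} {M : TransferFun r p} {M' : TransferFun q s}
    (hM : ∀ F : TransferFun p q, IsH2 F → IsH2 fun z => M z * F z * M' z)
    {Q : H2 p q} (hQ : Q ∈ delayedH2 p q k) {S : H2 r s}
    (hS : ∀ z, H2.eval S z = M z * H2.eval Q z * M' z) : S ∈ delayedH2 r s k := by
  obtain ⟨H, hH⟩ := (mem_delayedH2_iff Q).1 hQ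
  obtain ⟨H', hH'⟩ := hM _ ⟨H, rfl⟩
  refine (mem_delayedH2_iff S).2 ⟨H', fun z => ?_⟩
  rw [hS, hH, hH', Matrix.mul_smul, Matrix.smul_mul]

theorem delayedH2_anti {p q k l : ℕ} (h : k ≤ l) : delayedH2 p q l ≤ delayedH2 p q k :=
  fun _ hG i hi => hG i (hi.trans_le h)

/-- State feedback inverts the transfer function from the deviation of the input. -/
theorem stateSpace_mul_feedback {n p : ℕ} {A : Matrix (Fin n) (Fin n) ℝ}
    {B : Matrix (Fin n) (Fin p) ℝ} {K : Matrix (Fin p) (Fin n) ℝ} (hA : IsStable A)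
    (hK : IsStable (A + B * K)) (z : ExtDisc) :
    stateSpace A B (-K) 1 z * stateSpace (A + B * K) B K 1 z = 1 := by
  have h1 := hA.isUnit_det z
  have h2 := hK.isUnit_det z
  have h3 : ((z : ℂ) • (1 : Matrix (Fin n) (Fin n) ℂ) - toC (A + B * K)) =
      ((z : ℂ) • 1 - toC A) - toC B * toC K := by
    rw [toC_add, toC_mul, sub_add_eq_sub_sub]
  rw [stateSpace, stateSpace, toC_one, toC_neg]
  rw [h3] at h2 ⊢
  set S := (z : ℂ) • (1 : Matrix (Fin n) (Fin n) ℂ) - toC A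
  -- The resolvent identity for `S` and its perturbation `S - B K`; multiplied by `K` and `B`, it is
  -- the relation that makes the product collapse to 1.
  have h4 : S⁻¹ * (S - toC B * toC K) * (S - toC B * toC K)⁻¹ = S⁻¹ :=
    Matrix.mul_nonsing_inv_cancel_right _ _ h2
  rw [Matrix.mul_sub, Matrix.nonsing_inv_mul _ h1, Matrix.sub_mul, Matrix.one_mul] at h4
  have h5 : (S - toC B * toC K)⁻¹ = S⁻¹ + S⁻¹ * (toC B * toC K) * (S - toC B * toC K)⁻¹ :=
    sub_eq_iff_eq_add.1 h4
  have h6 : toC K * (S - toC B * toC K)⁻¹ * toC B = toC K * S⁻¹ * toC B +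
      toC K * S⁻¹ * toC B * (toC K * (S - toC B * toC K)⁻¹ * toC B) := by
    conv_lhs => rw [h5]
    simp only [Matrix.mul_add, Matrix.add_mul, Matrix.mul_assoc]
  rw [Matrix.neg_mul, Matrix.neg_mul, Matrix.add_mul, Matrix.mul_add, Matrix.one_mul,
    Matrix.mul_one, Matrix.neg_mul]
  nth_rewrite 2 [h6]
  abel

/-! ### Duality between control and estimation -/

namespace Plant

variable {n p₁ p₂ q₁ q₂ : ℕ} {P : Plant n p₁ p₂ q₁ q₂} {X Y : Matrix (Fin n) (Fin n) ℝ}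

/-- The transposed plant, which exchanges control and estimation. -/
def dual (P : Plant n p₁ p₂ q₁ q₂) : Plant n q₁ q₂ p₁ p₂ where
  A := P.Aᵀ
  B₁ := P.C₁ᵀ
  B₂ := P.C₂ᵀ
  C₁ := P.B₁ᵀ
  C₂ := P.B₂ᵀ
  D₁₂ := P.D₂₁ᵀ
  D₂₁ := P.D₁₂ᵀ

theorem Ω_dual (P : Plant n p₁ p₂ q₁ q₂) (Y : Matrix (Fin n) (Fin n) ℝ) :
    P.dual.Ω Y = P.Ψ Y := rfl

theorem K_dual (P : Plant n p₁ p₂ q₁ q₂) (hY : Y.IsSymm) : P.dual.K Y = (P.L Y)ᵀ := by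
  have h : (P.Ψ Y)ᵀ = P.Ψ Y := transpose_Ω (P := P.dual) hY
  rw [K, Ω_dual]
  simp [L, dual, Matrix.transpose_mul, Matrix.transpose_nonsing_inv, h, hY.eq, Matrix.mul_assoc]

theorem P₁₂_dual (P : Plant n p₁ p₂ q₁ q₂) (z : ExtDisc) : P.dual.P₁₂ z = (P.P₂₁ z)ᵀ := by
  rw [P₂₁, transpose_stateSpace]
  rfl

theorem IsEstimationRiccatiSolution.dual (hY : P.IsEstimationRiccatiSolution Y) :
    P.dual.IsControlRiccatiSolution Y where
  isSymm := hY.isSymm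
  isUnit := hY.isUnit
  eq := by
    rw [Ω_dual]
    exact hY.eq
  stable := by
    have h := hY.stable.transpose
    rwa [Matrix.transpose_add, Matrix.transpose_mul, ← K_dual P hY.isSymm] at h

theorem posDef_D_dual (hD : (P.D₂₁ * P.D₂₁ᵀ).PosDef) :
    (P.dual.D₁₂ᵀ * P.dual.D₁₂).PosDef := hD

/-- Through this identity every property of `W_R` follows from that of `W_L` for the transposed
plant. -/
theorem WR_eq_transpose (P : Plant n p₁ p₂ q₁ q₂) (hY : Y.IsSymm) (z : ExtDisc) :
    P.WR Y z = (P.dual.WL Y z)ᵀ := by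
  rw [WR, WL, K_dual P hY, Ω_dual, Matrix.transpose_mul, transpose_stateSpace, ← toC_transpose,
    Matrix.transpose_nonsing_inv, transpose_sqrt]
  simp [dual, Matrix.transpose_add, Matrix.transpose_mul]

namespace IsControlRiccatiSolution

theorem isH2_WL_mul (hX : P.IsControlRiccatiSolution X) {m : ℕ} {F : TransferFun p₂ m}
    (hF : IsH2 F) : IsH2 fun z => P.WL X z * F z := by
  simpa only [WL, Matrix.mul_assoc] using IsH2.stateSpace_mul hX.stable _ _ _ (hF.const_mul _)

theorem WLInv_mul_WL (hX : P.IsControlRiccatiSolution X) (hA : IsStable P.A)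
    (hD : (P.D₁₂ᵀ * P.D₁₂).PosDef) (z : ExtDisc) : P.WLInv X z * P.WL X z = 1 := by
  rw [WLInv, WL, Matrix.mul_assoc, ← Matrix.mul_assoc (stateSpace _ _ _ _ _),
    stateSpace_mul_feedback hA hX.stable, Matrix.one_mul, ← toC_mul,
    Matrix.mul_nonsing_inv _ (hX.isUnit_det_sqrt hD), toC_one]

theorem WL_mul_WLInv (hX : P.IsControlRiccatiSolution X) (hA : IsStable P.A)
    (hD : (P.D₁₂ᵀ * P.D₁₂).PosDef) (z : ExtDisc) : P.WL X z * P.WLInv X z = 1 :=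
  mul_eq_one_comm.1 (hX.WLInv_mul_WL hA hD z)

end IsControlRiccatiSolution

theorem isH2_WLInv_mul (hA : IsStable P.A) {m : ℕ} {F : TransferFun p₂ m}
    (hF : IsH2 F) : IsH2 fun z => P.WLInv X z * F z := by
  simpa only [WLInv, Matrix.mul_assoc] using
    (IsH2.stateSpace_mul hA P.B₂ (-P.K X) 1 hF).const_mul (toC (CFC.sqrt (P.Ω X)))

/-- The inverse of the spectral factor `W_R`. -/
def WRInv (P : Plant n p₁ p₂ q₁ q₂) (Y : Matrix (Fin n) (Fin n) ℝ) : TransferFun q₂ q₂ :=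
  fun z => (P.dual.WLInv Y z)ᵀ

theorem isH2_mul_WRInv (hA : IsStable P.A) {m : ℕ} {F : TransferFun m q₂}
    (hF : IsH2 F) : IsH2 fun z => F z * P.WRInv Y z := by
  simpa [Matrix.transpose_mul, WRInv] using
    (isH2_WLInv_mul (P := P.dual) (X := Y) hA.transpose hF.transpose).transpose

namespace IsEstimationRiccatiSolution

theorem isH2_mul_WR (hY : P.IsEstimationRiccatiSolution Y) {m : ℕ} {F : TransferFun m q₂}
    (hF : IsH2 F) : IsH2 fun z => F z * P.WR Y z := by
  simpa [Matrix.transpose_mul, WR_eq_transpose P hY.isSymm] using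
    (hY.dual.isH2_WL_mul hF.transpose).transpose

theorem WR_mul_WRInv (hY : P.IsEstimationRiccatiSolution Y) (hA : IsStable P.A)
    (hD : (P.D₂₁ * P.D₂₁ᵀ).PosDef) (z : ExtDisc) : P.WR Y z * P.WRInv Y z = 1 := by
  rw [WR_eq_transpose P hY.isSymm, WRInv, ← Matrix.transpose_mul,
    hY.dual.WLInv_mul_WL hA.transpose hD, Matrix.transpose_one]

theorem WRInv_mul_WR (hY : P.IsEstimationRiccatiSolution Y) (hA : IsStable P.A)
    (hD : (P.D₂₁ * P.D₂₁ᵀ).PosDef) (z : ExtDisc) : P.WRInv Y z * P.WR Y z = 1 :=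
  mul_eq_one_comm.1 (hY.WR_mul_WRInv hA hD z)

end IsEstimationRiccatiSolution

/-! ### The cost as a function of `W_L⁻¹ Q W_R⁻¹` -/

theorem isH2_closedLoop (hA : IsStable P.A) (Q : H2 p₂ q₂) : IsH2 (P.closedLoop Q) :=
  (hA.isH2_stateSpace _ _ _).add
    (IsH2.mul_stateSpace hA _ _ _ (IsH2.stateSpace_mul hA _ _ _ ⟨Q, rfl⟩))

theorem isH2_T (hA : IsStable P.A) : IsH2 (P.T X Y) :=
  ((hA.isH2_stateSpace _ _ _).const_mul _).mul_const _

/-- The cost of the model matching problem in terms of the parameter `W_L⁻¹ Q W_R⁻¹`. -/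
theorem exists_norm_closedLoop_sq_eq (hA : IsStable P.A) (hD₁₂ : (P.D₁₂ᵀ * P.D₁₂).PosDef)
    (hD₂₁ : (P.D₂₁ * P.D₂₁ᵀ).PosDef) (hX : P.IsControlRiccatiSolution X)
    (hY : P.IsEstimationRiccatiSolution Y) :
    ∃ c : ℝ, ∀ (Q : H2 p₂ q₂) (G : H2 q₁ p₁) (Z : H2 p₂ q₂), Q ∈ delayedH2 p₂ q₂ 1 →
      H2.eval G = P.closedLoop Q →
      (∀ z, H2.eval Z z = P.T X Y z + P.WLInv X z * H2.eval Q z * P.WRInv Y z) →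
      ‖G‖ ^ 2 = c + ‖Z‖ ^ 2 := by
  obtain ⟨c₁, h₁⟩ := hX.exists_energy_eq hA hD₁₂ P.B₁
  set R := CFC.sqrt (P.Ω X) with hR
  -- After the first completion of the square, the part of `V` independent of `Q` is `-Ω^{1/2} K (zI
  -- - A)⁻¹ B₁`. Transposed, it is the response of the dual plant to the impulse `(-Ω^{1/2} K)ᵀ`;
  -- the minus sign makes `T` appear with a plus sign below.
  obtain ⟨c₂, h₂⟩ := hY.dual.exists_energy_eq hA.transpose (posDef_D_dual hD₂₁)
    (-(R * P.K X))ᵀ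
  refine ⟨c₁ + c₂, fun Q G Z hQ hG hZ => ?_⟩
  obtain ⟨U, hU⟩ : IsH2 fun z => H2.eval Q z * P.P₂₁ z := IsH2.mul_stateSpace hA _ _ _ ⟨Q, rfl⟩
  have hU1 : U ∈ delayedH2 p₂ p₁ 1 := by
    refine mem_delayedH2_of_eval_eq (M := fun _ => 1) (M' := P.P₂₁) (fun F hF => ?_) hQ
      fun z => by rw [hU, Matrix.one_mul]
    simpa using! IsH2.mul_stateSpace hA P.B₁ P.C₂ P.D₂₁ hF
  obtain ⟨S, hS⟩ : IsH2 fun z => P.WLInv X z * H2.eval Q z := isH2_WLInv_mul hA ⟨Q, rfl⟩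
  have hS1 : S ∈ delayedH2 p₂ q₂ 1 := by
    refine mem_delayedH2_of_eval_eq (M := P.WLInv X) (M' := fun _ => 1) (fun F hF => ?_) hQ
      fun z => by rw [hS, Matrix.mul_one]
    simpa using isH2_WLInv_mul hA hF
  have hS2 : S.transpose ∈ delayedH2 q₂ p₂ 1 := fun i hi => by
    rw [← H2.coeff_eq_zero_iff, H2.coeff_transpose, (H2.coeff_eq_zero_iff S i).2 (hS1 i hi),
      Matrix.transpose_zero]
  obtain ⟨V, hV⟩ : IsH2 fun z => P.WLInv X z * H2.eval U z +
      (-toC R) * stateSpace P.A P.B₁ (P.K X) 0 z :=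
    (isH2_WLInv_mul hA ⟨U, rfl⟩).add ((hA.isH2_stateSpace _ _ _).const_mul _)
  have e₁ := h₁ U G V hU1
    (fun z => by rw [hG, hU, closedLoop, P₁₁, Matrix.mul_assoc])
    (fun z => by simp only [hV, Matrix.neg_mul, sub_eq_add_neg])
  have e₂ := h₂ S.transpose V.transpose Z.transpose hS2
    (fun z => by
      rw [H2.eval_transpose, H2.eval_transpose, P₁₂_dual, hV, hS, hU, ← Matrix.transpose_mul]
      have e : stateSpace P.dual.A (-(R * P.K X))ᵀ P.dual.C₁ 0 z =
          (stateSpace P.A P.B₁ (-(R * P.K X)) 0 z)ᵀ := by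
        rw [transpose_stateSpace]
        rfl
      rw [e, ← Matrix.transpose_add]
      simp only [stateSpace, toC_zero, toC_neg, toC_mul, Matrix.neg_mul, Matrix.mul_assoc, add_zero]
      rw [add_comm])
    (fun z => by
      rw [H2.eval_transpose, H2.eval_transpose, hZ, hS, Ω_dual, K_dual P hY.isSymm]
      have e : toC (CFC.sqrt (P.Ψ Y)) *
          stateSpace P.dual.A (-(R * P.K X))ᵀ (P.L Y)ᵀ 0 z =
          (stateSpace P.A (P.L Y) (-(R * P.K X)) 0 z * toC (CFC.sqrt (P.Ψ Y)))ᵀ := by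
        rw [Matrix.transpose_mul, transpose_stateSpace, ← toC_transpose, transpose_sqrt]
        rfl
      have e' : P.dual.WLInv Y z = (P.WRInv Y z)ᵀ := (Matrix.transpose_transpose _).symm
      rw [e, e', ← Matrix.transpose_mul, ← Matrix.transpose_sub, T]
      simp only [stateSpace, toC_zero, toC_neg, toC_mul, Matrix.neg_mul, Matrix.mul_assoc, add_zero, sub_neg_eq_add]
      rw [add_comm])
  rw [H2.norm_transpose, H2.norm_transpose] at e₂
  rw [e₁, e₂, add_assoc]

end Plant

end ModelMatching

end

/-! ### The projection argument -/

theorem mainTheorem4 {n p₁ p₂ q₁ q₂ : ℕ} (P : ModelMatching.Plant n p₁ p₂ q₁ q₂)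
    (hA : ModelMatching.IsStable P.A)
    (hD₁₂ : (P.D₁₂ᵀ * P.D₁₂).PosDef) (hD₂₁ : (P.D₂₁ * P.D₂₁ᵀ).PosDef)
    (X Y : Matrix (Fin n) (Fin n) ℝ)
    (hX : P.IsControlRiccatiSolution X) (hY : P.IsEstimationRiccatiSolution Y)
    (N : ℕ) (hN : 1 ≤ N) :
    (∀ Q : ModelMatching.H2 p₂ q₂, ModelMatching.IsH2 (P.closedLoop Q)) ∧
    ∃ T Q_N : ModelMatching.H2 p₂ q₂,
      T.eval = P.T X Y ∧
      (∀ z, Q_N.eval z =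
        -(P.WL X z *
          ModelMatching.H2.eval ((ModelMatching.delayedH2 p₂ q₂ (N + 1)).starProjection T) z *
          P.WR Y z)) ∧
      ∀ Q : ModelMatching.H2 p₂ q₂, P.IsDelayedOptimal (N + 1) Q ↔ Q = Q_N := by
  open ModelMatching ModelMatching.Plant in
  refine ⟨fun Q => isH2_closedLoop hA Q, ?_⟩
  obtain ⟨T, hT⟩ := isH2_T (P := P) (X := X) (Y := Y) hA
  set M := delayedH2 p₂ q₂ (N + 1) with hM
  set S := M.starProjection T with hS
  have hSM : S ∈ M := Submodule.starProjection_apply_mem M T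
  have hWH2 : ∀ F : TransferFun p₂ q₂, IsH2 F → IsH2 fun z => P.WL X z * F z * P.WR Y z :=
    fun F hF => hY.isH2_mul_WR (hX.isH2_WL_mul hF)
  have hIH2 : ∀ F : TransferFun p₂ q₂, IsH2 F → IsH2 fun z => P.WLInv X z * F z * P.WRInv Y z :=
    fun F hF => isH2_mul_WRInv hA (isH2_WLInv_mul hA hF)
  obtain ⟨Q₀, hQ₀⟩ := hWH2 _ ⟨-S, rfl⟩
  have hQ₀M : Q₀ ∈ M :=
    mem_delayedH2_of_eval_eq hWH2 (M.neg_mem hSM) fun z => congrFun hQ₀ z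
  -- The change of parameter `Φ Q = W_L⁻¹ Q W_R⁻¹`; `Q₀` above is the preimage of `-S`.
  choose Φ hΦ using fun Q : H2 p₂ q₂ => hIH2 _ ⟨Q, rfl⟩
  have hΦM : ∀ Q ∈ M, Φ Q ∈ M := fun Q hQ =>
    mem_delayedH2_of_eval_eq hIH2 hQ fun z => congrFun (hΦ Q) z
  have hΦS : ∀ Q, Φ Q = -S ↔ Q = Q₀ := by
    intro Q
    constructor
    · intro h
      refine H2.eval_injective _ _ (funext fun z => ?_)
      rw [hQ₀, ← h, hΦ]
      simp only [Matrix.mul_assoc, hY.WRInv_mul_WR hA hD₂₁ z, Matrix.mul_one]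
      rw [← Matrix.mul_assoc, hX.WL_mul_WLInv hA hD₁₂ z, Matrix.one_mul]
    · rintro rfl
      refine H2.eval_injective _ _ (funext fun z => ?_)
      rw [hΦ, hQ₀]
      simp only [Matrix.mul_assoc, hY.WR_mul_WRInv hA hD₂₁ z, Matrix.mul_one]
      rw [← Matrix.mul_assoc, hX.WLInv_mul_WL hA hD₁₂ z, Matrix.one_mul]
  obtain ⟨c, hc⟩ := exists_norm_closedLoop_sq_eq hA hD₁₂ hD₂₁ hX hY
  choose G hG using fun Q : H2 p₂ q₂ => isH2_closedLoop hA Q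
  -- Pythagoras: `T - S` is orthogonal to `M`, while `S + Φ Q` lies in `M`. The energy identity
  -- applies because `z^{-(N+1)} H₂` is contained in `z⁻¹ H₂`.
  have hcost : ∀ Q ∈ M, ‖G Q‖ ^ 2 = c + ‖T - S‖ ^ 2 + ‖S + Φ Q‖ ^ 2 := by
    intro Q hQ
    rw [hc Q (G Q) (T + Φ Q) (delayedH2_anti (by omega) hQ) (hG Q)
      fun z => by rw [H2.eval_add, hT, hΦ]]
    have horth : inner ℂ (T - S) (S + Φ Q) = 0 :=
      Submodule.starProjection_inner_eq_zero T _ (M.add_mem hSM (hΦM Q hQ))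
    have h := norm_add_sq_eq_norm_sq_add_norm_sq_of_inner_eq_zero (T - S) (S + Φ Q) horth
    rw [← add_assoc, sub_add_cancel] at h
    nlinarith
  have hle : ∀ Q ∈ M, ∀ Q' ∈ M, h2Norm (P.closedLoop Q) ≤ h2Norm (P.closedLoop Q') ↔
      ‖S + Φ Q‖ ^ 2 ≤ ‖S + Φ Q'‖ ^ 2 := by
    intro Q hQ Q' hQ'
    rw [← hG Q, ← hG Q', h2Norm_eval, h2Norm_eval, enorm_le_iff_norm_le,
      ← sq_le_sq₀ (norm_nonneg _) (norm_nonneg _), hcost Q hQ, hcost Q' hQ', add_le_add_iff_left]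
  have hΦ₀ : S + Φ Q₀ = 0 := by rw [(hΦS Q₀).2 rfl, add_neg_cancel]
  refine ⟨T, Q₀, hT, fun z => ?_, fun Q => ⟨fun hQ => ?_, ?_⟩⟩
  · simp only [hQ₀, H2.eval_neg, Matrix.mul_neg, Matrix.neg_mul, hS, hM]
  · have h := (hle Q hQ.1 Q₀ hQ₀M).1 (hQ.2 Q₀ hQ₀M)
    rw [hΦ₀, norm_zero, zero_pow two_ne_zero] at h
    have h0 : S + Φ Q = 0 := norm_eq_zero.1 (pow_eq_zero_iff two_ne_zero |>.1
      (le_antisymm h (sq_nonneg _)))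
    exact (hΦS Q).1 (eq_neg_of_add_eq_zero_right h0)
  · rintro rfl
    refine ⟨hQ₀M, fun Q' hQ' => (hle Q hQ₀M Q' hQ').2 ?_⟩
    rw [hΦ₀, norm_zero, zero_pow two_ne_zero]
    positivity
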